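/- Let $\mathbf L_t,\mathbf L_r\subset\mathbb R$ be intervals, let $P_{\rm T}\ge 0$ and $\sigma_z>0$, and let $h$ be a random channel kernel, i.e. a random element of $\mathcal L^2(\mathbf L_r\times\mathbf L_t)$ (complex valued, Lebesgue measure) on a probability space. Let $T_h:\mathcal L^2(\mathbf L_t)\to\mathcal L^2(\mathbf L_r)$, $(T_hx)(q)=\int_{\mathbf L_t}h(q,p)x(p)\,{\rm d}p$, be the associated random integral operator. Let $\phi_t:\mathbb C^{N_t}\to\mathcal L^2(\mathbf L_t)$ (continuous Tx array) and $\phi_r:\mathcal L^2(\mathbf L_r)\to\mathbb C^{N_r}$ (continuous Rx array) be linear maps with $\|\phi_t(v)\|\le 1$ whenever $\|v\|=1$ and $\|\phi_r(y)\|\le 1$ whenever $\|y\|=1$, and let $\mathbf H\in\mathbb C^{N_r\times N_t}$ be the matrix of $\phi_r\circ T_h\circ\phi_t$ in the standard bases. Define the capacities of the discrete system $y=\mathbf Hx+z$ and of the continuous system $Y=T_hX+Z$, with the same power budget $P_{\rm T}$ and white Gaussian noise of the same level $\sigma_z^2$, by $$C_{\rm dMIMO}=\sup_{\mathbf C_x\succeq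 0,\ {\rm tr}(\mathbf C_x)\le P_{\rm T}}\log\det\Big(\mathbf I+\frac1{\sigma_z^2}\mathbf H\mathbf C_x\mathbf H^{\mathsf H}\Big),\qquad C_{\rm cMIMO}=\sup_{T_X\succeq 0,\ {\rm tr}(T_X)\le P_{\rm T}}\log\det\Big(I+\frac1{\sigma_z^2}T_hT_XT_h^\dagger\Big),$$ where $T_X$ ranges over the positive trace class operators on $\mathcal L^2(\mathbf L_t)$ with trace at most $P_{\rm T}$, and the determinant on the right is the Fredholm determinant. Then $$C_{\rm dMIMO}\le C_{\rm cMIMO}\quad\text{almost surely}.$$ Moreover, both capacities are random variables (measurable up to null sets), and the ergodic capacities satisfy $\mathbb E[C_{\rm dMIMO}]\le\mathbb E[C_{\rm cMIMO}]$ (expectations in $[0,\infty]$). -/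

import Mathlib

open MeasureTheory
open scoped ENNReal ComplexOrder InnerProductSpace

noncomputable section

/-! ## Integral operators with square-integrable kernel -/

section IntegralOperator

variable {X Y : Type*} [MeasurableSpace X] [MeasurableSpace Y]
  {μ : Measure X} {ν : Measure Y} [SFinite μ] [SFinite ν]

/-- Almost every section of a square-integrable kernel is square-integrable. -/
theorem kernel_section_memLp (k : Lp ℂ 2 (ν.prod μ)) :
    ∀ᵐ q ∂ν, MemLp (fun p => k (q, p)) 2 μ := by
  have h1 := (Lp.memLp k).integrable_norm_pow (by norm_num)
  filter_upwards [h1.prod_right_ae, (Lp.aestronglyMeasurable k).prodMk_left] with q hq hm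
  exact (memLp_two_iff_integrable_sq_norm hm).2 (by simpa using hq)

/-- For a square-integrable kernel, `p ↦ k (q, p) f p` is integrable for almost every `q`. -/
theorem kernel_mul_integrable (k : Lp ℂ 2 (ν.prod μ)) (f : Lp ℂ 2 μ) :
    ∀ᵐ q ∂ν, Integrable (fun p => k (q, p) * f p) μ := by
  filter_upwards [kernel_section_memLp k] with q hq
  exact hq.integrable_mul (Lp.memLp f)

/-- Cauchy-Schwarz: `‖∫ k (·, p) f p dp‖₂ ≤ ‖k‖₂ ‖f‖₂`. -/
theorem kernel_eLpNorm_le (k : Lp ℂ 2 (ν.prod μ)) (f : Lp ℂ 2 μ) :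
    eLpNorm (fun q => ∫ p, k (q, p) * f p ∂μ) 2 ν ≤ eLpNorm k 2 (ν.prod μ) * eLpNorm f 2 μ := by
  have hk : AEMeasurable (fun z => ‖k z‖ₑ) (ν.prod μ) := (Lp.aestronglyMeasurable k).enorm
  have hf : AEMeasurable (fun p => ‖f p‖ₑ) μ := (Lp.aestronglyMeasurable f).enorm
  have key : ∀ᵐ q ∂ν, ‖∫ p, k (q, p) * f p ∂μ‖ₑ ^ (2 : ℝ) ≤
      (∫⁻ p, ‖k (q, p)‖ₑ ^ (2 : ℝ) ∂μ) * ∫⁻ p, ‖f p‖ₑ ^ (2 : ℝ) ∂μ := by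
    filter_upwards [kernel_section_memLp k] with q hq
    have h1 : ‖∫ p, k (q, p) * f p ∂μ‖ₑ ≤ ∫⁻ p, ‖k (q, p)‖ₑ * ‖f p‖ₑ ∂μ := by
      refine (enorm_integral_le_lintegral_enorm _).trans_eq ?_
      simp only [enorm_mul]
    have h2 := ENNReal.lintegral_mul_le_Lp_mul_Lq μ Real.HolderConjugate.two_two
      hq.1.enorm hf
    calc ‖∫ p, k (q, p) * f p ∂μ‖ₑ ^ (2 : ℝ)
        ≤ ((∫⁻ p, ‖k (q, p)‖ₑ ^ (2 : ℝ) ∂μ) ^ (1 / 2 : ℝ) *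
            (∫⁻ p, ‖f p‖ₑ ^ (2 : ℝ) ∂μ) ^ (1 / 2 : ℝ)) ^ (2 : ℝ) :=
          ENNReal.rpow_le_rpow (h1.trans h2) (by norm_num)
      _ = _ := by
          rw [ENNReal.mul_rpow_of_nonneg _ _ (by norm_num), ← ENNReal.rpow_mul,
            ← ENNReal.rpow_mul]
          norm_num
  rw [eLpNorm_eq_lintegral_rpow_enorm_toReal (by norm_num) (by norm_num),
    eLpNorm_eq_lintegral_rpow_enorm_toReal (by norm_num) (by norm_num),
    eLpNorm_eq_lintegral_rpow_enorm_toReal (by norm_num) (by norm_num),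
    ← ENNReal.mul_rpow_of_nonneg _ _ (by norm_num)]
  refine ENNReal.rpow_le_rpow ?_ (by norm_num)
  simp only [ENNReal.toReal_ofNat]
  rw [lintegral_prod _ (hk.pow_const _)]
  rw [← lintegral_mul_const'' _ (hk.pow_const _).lintegral_prod_right']
  exact lintegral_mono_ae key

/-- The function `q ↦ ∫ k (q, p) f p dp` is square-integrable. -/
theorem kernel_integral_memLp (k : Lp ℂ 2 (ν.prod μ)) (f : Lp ℂ 2 μ) :
    MemLp (fun q => ∫ p, k (q, p) * f p ∂μ) 2 ν := by
  refine ⟨?_, (kernel_eLpNorm_le k f).trans_lt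
    (ENNReal.mul_lt_top (Lp.memLp k).2 (Lp.memLp f).2)⟩
  have h : AEStronglyMeasurable (fun z : Y × X => k z * f z.2) (ν.prod μ) :=
    (Lp.aestronglyMeasurable k).mul (Lp.aestronglyMeasurable f).comp_snd
  exact h.integral_prod_right'

/-- The bounded operator `L²(μ) → L²(ν)` with kernel `k ∈ L²(ν × μ)`:
`(T_k f)(q) = ∫ k (q, p) f p dμ(p)`. -/
def integralOperator (k : Lp ℂ 2 (ν.prod μ)) : Lp ℂ 2 μ →L[ℂ] Lp ℂ 2 ν :=
  LinearMap.mkContinuous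
    { toFun := fun f => (kernel_integral_memLp k f).toLp
      map_add' := by
        intro f g
        rw [← MemLp.toLp_add]
        refine MemLp.toLp_congr _ _ ?_
        filter_upwards [kernel_mul_integrable k f, kernel_mul_integrable k g] with q hf hg
        simp only [Pi.add_apply]
        rw [← integral_add hf hg]
        refine integral_congr_ae ?_
        filter_upwards [Lp.coeFn_add f g] with p hp
        rw [hp, Pi.add_apply, mul_add]
      map_smul' := by
        intro c f
        rw [RingHom.id_apply, ← MemLp.toLp_const_smul]
        refine MemLp.toLp_congr _ _ (Filter.Eventually.of_forall fun q => ?_)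
        simp only [Pi.smul_apply, smul_eq_mul]
        rw [← integral_const_mul]
        refine integral_congr_ae ?_
        filter_upwards [Lp.coeFn_smul c f] with p hp
        rw [hp, Pi.smul_apply, smul_eq_mul]
        ring }
    ‖k‖ (by
      intro f
      change ‖(kernel_integral_memLp k f).toLp‖ ≤ _
      rw [Lp.norm_toLp, Lp.norm_def, Lp.norm_def, ← ENNReal.toReal_mul]
      exact ENNReal.toReal_mono
        (ENNReal.mul_ne_top (Lp.memLp k).2.ne (Lp.memLp f).2.ne) (kernel_eLpNorm_le k f))

/-- The defining formula of the integral operator. -/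
theorem integralOperator_ae_eq (k : Lp ℂ 2 (ν.prod μ)) (f : Lp ℂ 2 μ) :
    ∀ᵐ q ∂ν, integralOperator k f q = ∫ p, k (q, p) * f p ∂μ :=
  (kernel_integral_memLp k f).coeFn_toLp

end IntegralOperator

/-! ## Trace and Fredholm determinant on a Hilbert space -/

section Operators

variable (H : Type*) [NormedAddCommGroup H] [InnerProductSpace ℂ H] [CompleteSpace H]

/-- Index set of a fixed complete orthonormal basis of `H`. -/
def OnbIndex : Set H := (exists_hilbertBasis ℂ H).choose

/-- A fixed complete orthonormal basis of `H`. The trace and the Fredholm determinant below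
do not depend on it. -/
def onb : HilbertBasis (OnbIndex H) ℂ H := (exists_hilbertBasis ℂ H).choose_spec.choose

variable {H}

/-- The trace `∑ᵢ ⟨eᵢ, A eᵢ⟩ ∈ [0, ∞]` of a positive operator. It is finite exactly when the
positive operator `A` is of trace class. -/
def positiveTrace (A : H →L[ℂ] H) : ℝ≥0∞ :=
  ∑' i : OnbIndex H, ENNReal.ofReal (⟪onb H i, A (onb H i)⟫_ℂ).re

open Classical in
/-- The Fredholm determinant `det (I + A) = ∑ₖ tr (Λᵏ A)` of a trace class operator `A`.
The vectors `e_{i₁} ∧ ⋯ ∧ e_{iₖ}`, one for each `k`-element set `{i₁, …, iₖ}` of indices, are an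
orthonormal basis of `Λᵏ H`, so `tr (Λᵏ A)` is the sum of the principal `k × k` minors of the
matrix `⟨eᵢ, A eⱼ⟩`, and `det (I + A)` is the sum of all its finite principal minors. -/
def fredholmDet (A : H →L[ℂ] H) : ℂ :=
  ∑' s : Finset (OnbIndex H),
    (Matrix.of fun i j : s => ⟪onb H i, A (onb H j)⟫_ℂ).det

end Operators

/-! ## The discrete and the continuous system -/

/-- `L²(L)` for a set `L` of reals with Lebesgue measure. -/
abbrev L2 (L : Set ℝ) : Type := Lp ℂ 2 (volume.restrict L)

/-- Square-integrable channel kernels `h (q, p)`, `q ∈ Lr`, `p ∈ Lt`. -/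
abbrev ChannelKernel (Lr Lt : Set ℝ) : Type :=
  Lp ℂ 2 ((volume.restrict Lr).prod (volume.restrict Lt))

/-- The channel operator `T_h : L²(Lt) → L²(Lr)`, `(T_h x)(q) = ∫_{Lt} h (q, p) x p dp`. -/
def channelOperator {Lr Lt : Set ℝ} (h : ChannelKernel Lr Lt) : L2 Lt →L[ℂ] L2 Lr :=
  integralOperator h

/-- A continuous transmit array of `n` elements: a linear map `ℂⁿ → L²(Lt)` that sends unit
vectors to vectors of norm at most one. -/
structure ContinuousTxArray (n : ℕ) (Lt : Set ℝ) where
  toLinearMap : EuclideanSpace ℂ (Fin n) →ₗ[ℂ] L2 Lt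
  norm_le_one : ∀ v, ‖v‖ = 1 → ‖toLinearMap v‖ ≤ 1

/-- A continuous receive array of `n` elements: a linear map `L²(Lr) → ℂⁿ` that sends unit
vectors to vectors of norm at most one. -/
structure ContinuousRxArray (n : ℕ) (Lr : Set ℝ) where
  toLinearMap : L2 Lr →ₗ[ℂ] EuclideanSpace ℂ (Fin n)
  norm_le_one : ∀ y, ‖y‖ = 1 → ‖toLinearMap y‖ ≤ 1

/-- The discrete channel matrix induced by a channel operator `T`: the matrix of
`φr ∘ T ∘ φt : ℂ^Nt → ℂ^Nr` in the standard bases. -/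
def inducedChannel {Nt Nr : ℕ} {Lt Lr : Set ℝ} (φr : ContinuousRxArray Nr Lr)
    (T : L2 Lt →L[ℂ] L2 Lr) (φt : ContinuousTxArray Nt Lt) : Matrix (Fin Nr) (Fin Nt) ℂ :=
  Matrix.of fun i j => φr.toLinearMap (T (φt.toLinearMap (EuclideanSpace.single j 1))) i

/-- `log det (I + σ⁻² H C Hᴴ)`. -/
def discreteRate {Nt Nr : ℕ} (H : Matrix (Fin Nr) (Fin Nt) ℂ) (σ : ℝ)
    (C : Matrix (Fin Nt) (Fin Nt) ℂ) : ℝ :=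
  Real.log (1 + ((1 / σ ^ 2 : ℝ) : ℂ) • (H * C * H.conjTranspose)).det.re

/-- Capacity of the discrete system `y = H x + z` with power budget `P` and noise covariance
`σ² I`: the supremum of the (nonnegative) rates over all input covariance matrices. -/
def discreteCapacity {Nt Nr : ℕ} (H : Matrix (Fin Nr) (Fin Nt) ℂ) (P σ : ℝ) : ℝ≥0∞ :=
  ⨆ C ∈ {C : Matrix (Fin Nt) (Fin Nt) ℂ | C.PosSemidef ∧ C.trace.re ≤ P},
    ENNReal.ofReal (discreteRate H σ C)

/-- `log det (I + σ⁻² T S T†)` with the Fredholm determinant. -/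
def continuousRate {Lt Lr : Set ℝ} (T : L2 Lt →L[ℂ] L2 Lr) (σ : ℝ)
    (S : L2 Lt →L[ℂ] L2 Lt) : ℝ :=
  Real.log
    (fredholmDet (((1 / σ ^ 2 : ℝ) : ℂ) • (T ∘L S ∘L ContinuousLinearMap.adjoint T))).re

/-- Capacity of the continuous system with channel operator `T`, power budget `P` and white noise
of level `σ²`: the supremum of the (nonnegative) rates over all input covariance operators, that
is, positive operators of trace at most `P`. -/
def continuousCapacity {Lt Lr : Set ℝ} (T : L2 Lt →L[ℂ] L2 Lr) (P σ : ℝ) : ℝ≥0∞ :=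
  ⨆ S ∈ {S : L2 Lt →L[ℂ] L2 Lt | S.IsPositive ∧ positiveTrace S ≤ ENNReal.ofReal P},
    ENNReal.ofReal (continuousRate T σ S)

end

/-! The inequality is deterministic: it holds for every bounded channel operator `T`. Given an input
covariance `C = D Dᴴ`, put `M = φt D` and `S = M M†`. Since `‖φt‖ ≤ 1`, `tr S = ‖M‖²_HS ≤ ‖D‖²_HS =
tr C`, so `S` is admissible. Let `u k` be the columns of `N = σ⁻¹ T M`. By Sylvester's identity the
continuous rate of `S` is the log determinant of `1 + gram u` (`fredholmDet_comp_adjoint`), and the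
discrete rate of `C` is that of `1 + gram (φr ∘ u)`. As `‖φr‖ ≤ 1`, the second Gram matrix lies
below the first in the Loewner order, and `det (1 + ·)` is monotone
(`Matrix.PosSemidef.det_one_add_mono`).

For positive trace class `A` the minors defining `fredholmDet A` are nonnegative, and those inside a
finite index set `F` sum to the determinant of a compression, at most `exp (tr A)`. Hence the
Fredholm determinant is the increasing limit of compression determinants. This gives Sylvester's
identity by passage to the limit, and shows that both capacities are suprema of continuous
functions, hence lower semicontinuous and Borel. -/

namespace Matrix

/-! ### Determinants of `1 + A` and principal minors -/

variable {n : Type*} [Fintype n] [DecidableEq n]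

/-- Evaluate the characteristic polynomial at `-1`; the sign `(-1)ⁿ` appears on both sides and
cancels. -/
theorem IsHermitian.det_one_add_eq_prod {A : Matrix n n ℂ} (hA : A.IsHermitian) :
    (1 + A).det = ∏ i, ((1 + hA.eigenvalues i : ℝ) : ℂ) := by
  have h : (-1 : Matrix n n ℂ) - A = -(1 + A) := by abel
  have h1 := congrArg (Polynomial.eval (-1)) hA.charpoly_eq
  rw [eval_charpoly, map_neg, map_one, h, det_neg, Polynomial.eval_prod] at h1
  have h2 : ∀ i, Polynomial.eval (-1 : ℂ) (Polynomial.X - Polynomial.C (hA.eigenvalues i : ℂ)) =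
      (-1) * ((1 + hA.eigenvalues i : ℝ) : ℂ) := by
    intro i
    simp only [Polynomial.eval_sub, Polynomial.eval_X, Polynomial.eval_C]
    push_cast
    ring
  have h3 := h1.trans (Finset.prod_congr rfl fun i _ => h2 i)
  rw [Finset.prod_mul_distrib, Finset.prod_const, Finset.card_univ] at h3
  exact mul_left_cancel₀ (pow_ne_zero _ (by norm_num)) h3

theorem PosSemidef.one_le_det_one_add {A : Matrix n n ℂ} (hA : A.PosSemidef) :
    1 ≤ (1 + A).det := by
  rw [hA.isHermitian.det_one_add_eq_prod, ← Complex.ofReal_prod]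
  exact_mod_cast Finset.one_le_prod fun i => by
    simpa using hA.eigenvalues_nonneg i

theorem PosSemidef.det_one_add_re_le_exp_trace {A : Matrix n n ℂ} (hA : A.PosSemidef) :
    (1 + A).det.re ≤ Real.exp A.trace.re := by
  rw [hA.isHermitian.det_one_add_eq_prod, ← Complex.ofReal_prod, Complex.ofReal_re,
    hA.isHermitian.trace_eq_sum_eigenvalues, Complex.re_sum]
  exact Real.prod_one_add_le_exp_sum _ hA.eigenvalues_nonneg

/-- With `B - A = Eᴴ E`, the matrix determinant lemma gives `det (1 + B) = det (1 + A) * det (1 + E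
(1 + A)⁻¹ Eᴴ)`, whose last factor is at least one. -/
theorem PosSemidef.det_one_add_mono {A B : Matrix n n ℂ} (hA : A.PosSemidef)
    (hAB : (B - A).PosSemidef) : (1 + A).det ≤ (1 + B).det := by
  open scoped MatrixOrder in
  obtain ⟨E, hE⟩ := CStarAlgebra.nonneg_iff_eq_star_mul_self.mp hAB.nonneg
  have hpos : (1 + A).PosDef := PosDef.one.add_posSemidef hA
  have hB : 1 + B = (1 + A) + Eᴴ * E := by
    rw [← star_eq_conjTranspose, ← hE]; abel
  rw [hB, det_add_mul _ _ hpos.det_pos.ne'.isUnit]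
  exact le_mul_of_one_le_right hpos.det_pos.le
    (hpos.posSemidef.inv.mul_mul_conjTranspose_same E).one_le_det_one_add

/-- `det (1 + A)` is the sum of all principal minors of `A`. -/
theorem det_one_add_eq_sum_minors {R : Type*} [CommRing R] (A : Matrix n n R) :
    (1 + A).det = ∑ s : Finset n, (A.submatrix ((↑) : s → n) (↑)).det := by
  have h : (detRowAlternating : (n → R) [⋀^n]→ₗ[R] R)
      (A.row + (1 : Matrix n n R).row) = (1 + A).det := by rw [add_comm 1 A]; rfl
  rw [← h, AlternatingMap.map_add_univ]
  exact Finset.sum_congr rfl fun s _ => det_piecewise_one_eq_submatrix_det A s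

theorem det_one_add_eq_sum_powerset {ι R : Type*} [DecidableEq ι] [CommRing R]
    (A : Matrix ι ι R) (F : Finset ι) :
    (1 + A.submatrix ((↑) : F → ι) (↑)).det =
      ∑ s ∈ F.powerset, (A.submatrix ((↑) : s → ι) (↑)).det := by
  rw [det_one_add_eq_sum_minors]
  refine Finset.sum_bij' (fun t _ => t.map (Function.Embedding.subtype _))
    (fun s _ => s.subtype (· ∈ F)) ?_ ?_ ?_ ?_ ?_
  · intro t _
    rw [Finset.mem_powerset]
    intro x hx
    obtain ⟨y, -, rfl⟩ := Finset.mem_map.1 hx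
    exact y.2
  · simp
  · intro t _
    ext x
    simp
  · intro s hs
    rw [Finset.mem_powerset] at hs
    ext x
    simpa using fun hx => hs hx
  · intro t _
    rw [← det_submatrix_equiv_self (t.equivMap (Function.Embedding.subtype _))]
    rfl

/-- The minors are nonnegative. Any finite family of index sets lies in the powerset of its union
`F`, over which the minors sum to `det (1 + A_F) ≤ exp (tr A_F)`; this bounds all partial sums by
the exponential of the full trace. -/
theorem summable_minors {ι : Type*} [DecidableEq ι] (A : Matrix ι ι ℂ)
    (hA : ∀ F : Finset ι, (A.submatrix ((↑) : F → ι) (↑)).PosSemidef)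
    (hs : Summable fun i => (A i i).re) :
    Summable fun s : Finset ι => (A.submatrix ((↑) : s → ι) (↑)).det := by
  have hnn : ∀ s : Finset ι, 0 ≤ (A.submatrix ((↑) : s → ι) (↑)).det := fun s =>
    (hA s).det_nonneg
  have hre : ∀ s : Finset ι, (A.submatrix ((↑) : s → ι) (↑)).det =
      (((A.submatrix ((↑) : s → ι) (↑)).det.re : ℝ) : ℂ) := fun s =>
    Complex.eq_re_of_ofReal_le (r := 0) (by simpa using hnn s)
  have hdiag : ∀ i, 0 ≤ (A i i).re := fun i =>
    (Complex.le_def.1 ((hA {i}).diag_nonneg (i := ⟨i, by simp⟩))).1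
  have key : Summable fun s : Finset ι => (A.submatrix ((↑) : s → ι) (↑)).det.re := by
    refine summable_of_sum_le (c := Real.exp (∑' i, (A i i).re))
      (fun s => (Complex.le_def.1 (hnn s)).1) fun T => ?_
    calc ∑ s ∈ T, (A.submatrix ((↑) : s → ι) (↑)).det.re
        ≤ ∑ s ∈ (T.biUnion id).powerset, (A.submatrix ((↑) : s → ι) (↑)).det.re :=
          Finset.sum_le_sum_of_subset_of_nonneg (fun s hs => Finset.mem_powerset.mpr
            (Finset.subset_biUnion_of_mem id hs)) fun s _ _ => (Complex.le_def.1 (hnn s)).1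
      _ = (1 + A.submatrix ((↑) : ↥(T.biUnion id) → ι) (↑)).det.re := by
          rw [det_one_add_eq_sum_powerset, Complex.re_sum]
      _ ≤ Real.exp (A.submatrix ((↑) : ↥(T.biUnion id) → ι) (↑)).trace.re :=
          (hA _).det_one_add_re_le_exp_trace
      _ ≤ Real.exp (∑' i, (A i i).re) := by
          refine Real.exp_le_exp.mpr ?_
          rw [trace, Complex.re_sum]
          refine le_trans (le_of_eq ?_) (hs.sum_le_tsum (T.biUnion id) fun i _ => hdiag i)
          exact Finset.sum_coe_sort (T.biUnion id) fun i => (A i i).re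
  exact (Complex.hasSum_ofReal.2 key.hasSum).summable.congr fun s => (hre s).symm

end Matrix

noncomputable section

/-! ### Hilbert-Schmidt norms and traces -/

section HilbertSchmidt

variable {H K G : Type*} [NormedAddCommGroup H] [InnerProductSpace ℂ H]
  [NormedAddCommGroup K] [InnerProductSpace ℂ K] [NormedAddCommGroup G] [InnerProductSpace ℂ G]

/-- Parseval in `[0, ∞]`, where double sums may be exchanged without summability conditions. -/
theorem HilbertBasis.tsum_enorm_inner_sq {ι : Type*} (b : HilbertBasis ι ℂ H) (x : H) :
    ∑' i, ‖⟪b i, x⟫_ℂ‖ₑ ^ 2 = ‖x‖ₑ ^ 2 := by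
  have h := Complex.hasSum_re (b.hasSum_inner_mul_inner x x)
  have h1 : ∀ i, (⟪x, b i⟫_ℂ * ⟪b i, x⟫_ℂ).re = ‖⟪b i, x⟫_ℂ‖ ^ 2 := by
    intro i
    rw [← inner_conj_symm, ← Complex.normSq_eq_conj_mul_self, Complex.ofReal_re,
      Complex.normSq_eq_norm_sq]
  simp only [h1] at h
  have h2 : (⟪x, x⟫_ℂ).re = ‖x‖ ^ 2 := inner_self_eq_norm_sq (𝕜 := ℂ) x
  rw [h2] at h
  have h3 := ENNReal.ofReal_tsum_of_nonneg (fun i => by positivity) h.summable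
  rw [h.tsum_eq] at h3
  simpa [ENNReal.ofReal_pow, ofReal_norm] using h3.symm

theorem tsum_enorm_sq_comp_le {ι : Type*} (b : ι → H) (T : K →L[ℂ] G) (R : H →L[ℂ] K) :
    ∑' i, ‖T (R (b i))‖ₑ ^ 2 ≤ ‖T‖ₑ ^ 2 * ∑' i, ‖R (b i)‖ₑ ^ 2 := by
  rw [← ENNReal.tsum_mul_left]
  refine ENNReal.tsum_le_tsum fun i => ?_
  rw [← mul_pow]
  gcongr
  exact T.le_opENorm _

variable [CompleteSpace H] [CompleteSpace K]

/-- The Hilbert-Schmidt norms of an operator and of its adjoint agree, in any pair of bases. -/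
theorem tsum_enorm_sq_adjoint {ι κ : Type*} (b : HilbertBasis ι ℂ H) (c : HilbertBasis κ ℂ K)
    (M : H →L[ℂ] K) :
    ∑' i, ‖M (b i)‖ₑ ^ 2 = ∑' k, ‖ContinuousLinearMap.adjoint M (c k)‖ₑ ^ 2 := by
  simp only [← c.tsum_enorm_inner_sq (M _), ← b.tsum_enorm_inner_sq (ContinuousLinearMap.adjoint M _)]
  rw [ENNReal.tsum_comm]
  refine tsum_congr fun k => tsum_congr fun i => ?_
  rw [ContinuousLinearMap.adjoint_inner_right, ← inner_conj_symm, RCLike.enorm_conj]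

theorem ContinuousLinearMap.IsPositive.exists_eq_adjoint_comp {A : H →L[ℂ] H}
    (hA : A.IsPositive) : ∃ R : H →L[ℂ] H, A = ContinuousLinearMap.adjoint R ∘L R :=
  CStarAlgebra.nonneg_iff_eq_star_mul_self.mp
    ((ContinuousLinearMap.nonneg_iff_isPositive A).2 hA)

/-- Absorbs the noise level into the channel, so that facts about `T S T†` apply to the scaled
operator. -/
theorem ContinuousLinearMap.inv_sq_smul_conj_adjoint (σ : ℝ) (T : H →L[ℂ] K) (S : H →L[ℂ] H) :
    ((1 / σ ^ 2 : ℝ) : ℂ) • (T ∘L S ∘L ContinuousLinearMap.adjoint T) =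
      (((1 / σ : ℝ) : ℂ) • T) ∘L S ∘L ContinuousLinearMap.adjoint (((1 / σ : ℝ) : ℂ) • T) := by
  rw [map_smulₛₗ, Complex.conj_ofReal]
  ext1 x
  simp [smul_smul, pow_two]

theorem positiveTrace_adjoint_comp (R : H →L[ℂ] K) :
    positiveTrace (ContinuousLinearMap.adjoint R ∘L R) = ∑' i, ‖R (onb H i)‖ₑ ^ 2 := by
  refine tsum_congr fun i => ?_
  rw [ContinuousLinearMap.comp_apply, ContinuousLinearMap.adjoint_inner_right]
  have h2 : (⟪R (onb H i), R (onb H i)⟫_ℂ).re = ‖R (onb H i)‖ ^ 2 :=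
    inner_self_eq_norm_sq (𝕜 := ℂ) _
  rw [h2, ENNReal.ofReal_pow (norm_nonneg _), ofReal_norm]

/-- `tr (T S T†) ≤ ‖T‖² tr S` for a positive operator `S`. -/
theorem positiveTrace_conj_adjoint_le {S : H →L[ℂ] H} (hS : S.IsPositive) (T : H →L[ℂ] K) :
    positiveTrace (T ∘L S ∘L ContinuousLinearMap.adjoint T) ≤ ‖T‖ₑ ^ 2 * positiveTrace S := by
  obtain ⟨R, rfl⟩ := hS.exists_eq_adjoint_comp
  have h : T ∘L (ContinuousLinearMap.adjoint R ∘L R) ∘L ContinuousLinearMap.adjoint T =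
      ContinuousLinearMap.adjoint (R ∘L ContinuousLinearMap.adjoint T) ∘L
        (R ∘L ContinuousLinearMap.adjoint T) := by
    rw [ContinuousLinearMap.adjoint_comp, ContinuousLinearMap.adjoint_adjoint]
    rfl
  -- Passing to adjoints turns `R T†` into `T R†` and `R` into `R†`, so `T` acts last and its
  -- operator norm factors out.
  rw [h, positiveTrace_adjoint_comp, positiveTrace_adjoint_comp,
    tsum_enorm_sq_adjoint (onb K) (onb H), tsum_enorm_sq_adjoint (onb H) (onb H),
    ContinuousLinearMap.adjoint_comp, ContinuousLinearMap.adjoint_adjoint]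
  exact tsum_enorm_sq_comp_le _ _ _

end HilbertSchmidt

/-! ### The Fredholm determinant as a limit of compressions -/

section Fredholm

variable {H : Type*} [NormedAddCommGroup H] [InnerProductSpace ℂ H] [CompleteSpace H]

/-- The matrix of an operator in the fixed orthonormal basis. -/
def onbMatrix (A : H →L[ℂ] H) : Matrix (OnbIndex H) (OnbIndex H) ℂ :=
  Matrix.of fun i j => ⟪onb H i, A (onb H j)⟫_ℂ

open Classical in
/-- The determinant `det (I + P_F A P_F)` of the compression to the span of finitely many
basis vectors. -/
def compressionDet (A : H →L[ℂ] H) (F : Finset (OnbIndex H)) : ℂ :=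
  (1 + (onbMatrix A).submatrix ((↑) : F → OnbIndex H) (↑)).det

theorem posSemidef_onbMatrix_submatrix {A : H →L[ℂ] H} (hA : A.IsPositive)
    (F : Finset (OnbIndex H)) :
    ((onbMatrix A).submatrix ((↑) : F → OnbIndex H) (↑)).PosSemidef := by
  obtain ⟨R, rfl⟩ := hA.exists_eq_adjoint_comp
  have h : (onbMatrix (ContinuousLinearMap.adjoint R ∘L R)).submatrix
      ((↑) : F → OnbIndex H) (↑) = Matrix.gram ℂ fun i : F => R (onb H i) := by
    ext i j
    simp [onbMatrix, Matrix.gram_apply, ContinuousLinearMap.adjoint_inner_right]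
  rw [h]
  exact Matrix.posSemidef_gram ℂ _

theorem summable_re_inner_of_positiveTrace_ne_top {A : H →L[ℂ] H} (hA : A.IsPositive)
    (ht : positiveTrace A ≠ ∞) : Summable fun i => (⟪onb H i, A (onb H i)⟫_ℂ).re := by
  refine (ENNReal.summable_toReal ht).congr fun i => ?_
  exact ENNReal.toReal_ofReal (hA.re_inner_nonneg_right (onb H i))

/-- The Fredholm determinant of a positive trace class operator is the limit of the determinants
of its finite compressions. -/
theorem tendsto_compressionDet {A : H →L[ℂ] H} (hA : A.IsPositive)
    (ht : positiveTrace A ≠ ∞) :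
    Filter.Tendsto (compressionDet A) Filter.atTop (nhds (fredholmDet A)) := by
  classical
  have h := Matrix.summable_minors (onbMatrix A) (posSemidef_onbMatrix_submatrix hA)
    (summable_re_inner_of_positiveTrace_ne_top hA ht)
  -- The powersets of finite sets `F` are cofinal among finite families of index sets.
  have h1 := (h.hasSum : Filter.Tendsto _ _ _).comp Filter.tendsto_finset_powerset_atTop_atTop
  refine Filter.Tendsto.congr (fun F => ?_) (h1.trans (le_of_eq ?_))
  · rw [compressionDet]
    simpa using (Matrix.det_one_add_eq_sum_powerset (onbMatrix A) F).symm
  · rw [fredholmDet]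
    congr 1

theorem continuous_compressionDet (F : Finset (OnbIndex H)) :
    Continuous fun A : H →L[ℂ] H => compressionDet A F := by
  classical
  refine Continuous.matrix_det (continuous_const.add
    (continuous_pi fun i => continuous_pi fun j => ?_))
  simp only [Matrix.submatrix_apply, onbMatrix, Matrix.of_apply]
  fun_prop

theorem compressionDet_mono {A : H →L[ℂ] H} (hA : A.IsPositive) :
    Monotone (compressionDet A) := by
  classical
  intro F G hFG
  have h (F) : compressionDet A F = ∑ s ∈ F.powerset,
      ((onbMatrix A).submatrix ((↑) : s → OnbIndex H) (↑)).det := by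
    rw [compressionDet, ← Matrix.det_one_add_eq_sum_powerset]
  rw [h, h]
  exact Finset.sum_le_sum_of_subset_of_nonneg (Finset.powerset_mono.2 hFG)
    fun s _ _ => (posSemidef_onbMatrix_submatrix hA s).det_nonneg

theorem compressionDet_le_fredholmDet {A : H →L[ℂ] H} (hA : A.IsPositive)
    (ht : positiveTrace A ≠ ∞) (F : Finset (OnbIndex H)) :
    compressionDet A F ≤ fredholmDet A :=
  (compressionDet_mono hA).ge_of_tendsto (tendsto_compressionDet hA ht) F

theorem one_le_compressionDet {A : H →L[ℂ] H} (hA : A.IsPositive) (F : Finset (OnbIndex H)) :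
    1 ≤ compressionDet A F := by
  classical
  exact (posSemidef_onbMatrix_submatrix hA F).one_le_det_one_add

theorem one_le_re_fredholmDet {A : H →L[ℂ] H} (hA : A.IsPositive)
    (ht : positiveTrace A ≠ ∞) : 1 ≤ (fredholmDet A).re :=
  (Complex.le_def.1 ((one_le_compressionDet hA ∅).trans
    (compressionDet_le_fredholmDet hA ht ∅))).1

/-- Each compression determinant is continuous in `A` for the operator norm, so this form of the
rate yields lower semicontinuity in the channel. -/
theorem ofReal_log_fredholmDet_eq_iSup {A : H →L[ℂ] H} (hA : A.IsPositive)
    (ht : positiveTrace A ≠ ∞) :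
    ENNReal.ofReal (Real.log (fredholmDet A).re) =
      ⨆ F, ENNReal.ofReal (Real.log (compressionDet A F).re) := by
  have h1 : ∀ F, 1 ≤ (compressionDet A F).re := fun F =>
    (Complex.le_def.1 (one_le_compressionDet hA F)).1
  refine le_antisymm ?_ (iSup_le fun F => ENNReal.ofReal_le_ofReal (Real.log_le_log
    (zero_lt_one.trans_le (h1 F)) (Complex.le_def.1 (compressionDet_le_fredholmDet hA ht F)).1))
  have hpos : (fredholmDet A).re ≠ 0 := (zero_lt_one.trans_le (one_le_re_fredholmDet hA ht)).ne'
  have hlim : Filter.Tendsto (fun F => ENNReal.ofReal (Real.log (compressionDet A F).re))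
      Filter.atTop (nhds (ENNReal.ofReal (Real.log (fredholmDet A).re))) :=
    ENNReal.tendsto_ofReal (((Complex.continuous_re.tendsto _).comp
      (tendsto_compressionDet hA ht)).log hpos)
  exact le_of_tendsto' hlim fun F => le_iSup (fun F => ENNReal.ofReal (Real.log
    (compressionDet A F).re)) F

/-- `det (I + N N†) = det (I + N† N)` for an operator `N` on a finite dimensional space, with the
Gram matrix of the columns of `N` on the right. -/
theorem fredholmDet_comp_adjoint {n : Type*} [Fintype n] [DecidableEq n]
    (N : EuclideanSpace ℂ n →L[ℂ] H)
    (ht : positiveTrace (N ∘L ContinuousLinearMap.adjoint N) ≠ ∞) :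
    fredholmDet (N ∘L ContinuousLinearMap.adjoint N) =
      (1 + Matrix.gram ℂ fun k => N (EuclideanSpace.single k 1)).det := by
  classical
  have hA : (N ∘L ContinuousLinearMap.adjoint N).IsPositive := 
    ContinuousLinearMap.isPositive_self_comp_adjoint N
  refine tendsto_nhds_unique (tendsto_compressionDet hA ht) ?_
  set u : n → H := fun k => N (EuclideanSpace.single k 1) with hu
  -- The compression of `N N†` to `F` is `U Uᴴ`. Sylvester replaces it by `Uᴴ U`, whose size does
  -- not depend on `F` and whose entries are partial Parseval sums for the Gram matrix.
  let U (F : Finset (OnbIndex H)) : Matrix F n ℂ := Matrix.of fun i k => ⟪onb H i, u k⟫_ℂ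
  have h1 (F) : compressionDet (N ∘L ContinuousLinearMap.adjoint N) F =
      (1 + (U F).conjTranspose * U F).det := by
    rw [← Matrix.det_one_add_mul_comm, compressionDet]
    congr 2
    ext i j
    rw [Matrix.submatrix_apply, onbMatrix, Matrix.of_apply, Matrix.mul_apply,
      ContinuousLinearMap.comp_apply, ← ContinuousLinearMap.adjoint_inner_left,
      ← (EuclideanSpace.basisFun n ℂ).sum_inner_mul_inner]
    refine Finset.sum_congr rfl fun k _ => ?_
    simp only [EuclideanSpace.basisFun_apply, U, Matrix.conjTranspose_apply, Matrix.of_apply, hu]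
    rw [ContinuousLinearMap.adjoint_inner_left, ContinuousLinearMap.adjoint_inner_right,
      ← inner_conj_symm (N _) (onb H j)]
    rfl
  have h2 : Filter.Tendsto (fun F => (U F).conjTranspose * U F) Filter.atTop
      (nhds (Matrix.gram ℂ u)) := by
    refine tendsto_pi_nhds.2 fun k => tendsto_pi_nhds.2 fun l => ?_
    refine Filter.Tendsto.congr (fun F => ?_) ((onb H).hasSum_inner_mul_inner (u k) (u l))
    rw [Matrix.mul_apply]
    simp only [U, Matrix.conjTranspose_apply, Matrix.of_apply]
    rw [← Finset.sum_coe_sort]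
    refine Finset.sum_congr rfl fun i _ => ?_
    rw [← inner_conj_symm (u k)]
    rfl
  simp only [funext h1]
  exact ((Continuous.matrix_det continuous_id).tendsto _).comp
    (tendsto_const_nhds.add h2)

end Fredholm

end

noncomputable section

/-! ### Continuity of the channel operator in its kernel -/

section IntegralOperatorContinuity

variable {X Y : Type*} [MeasurableSpace X] [MeasurableSpace Y]
  {μ : Measure X} {ν : Measure Y} [SFinite μ] [SFinite ν]

theorem integralOperator_sub (k l : Lp ℂ 2 (ν.prod μ)) :
    integralOperator (k - l) = integralOperator k - integralOperator l := by
  ext1 f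
  refine Lp.ext ?_
  rw [sub_apply]
  filter_upwards [integralOperator_ae_eq (k - l) f, integralOperator_ae_eq k f,
    integralOperator_ae_eq l f, Lp.coeFn_sub (integralOperator k f) (integralOperator l f),
    kernel_mul_integrable k f, kernel_mul_integrable l f,
    Measure.ae_ae_of_ae_prod (Lp.coeFn_sub k l)] with q h1 h2 h3 h4 h5 h6 h7
  rw [h1, h4, Pi.sub_apply, h2, h3, ← integral_sub h5 h6]
  refine integral_congr_ae ?_
  filter_upwards [h7] with p hp
  rw [hp, Pi.sub_apply, sub_mul]

/-- The operator norm is at most the `L²` norm of the kernel. Measurability of the random kernel is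
transported along this map. -/
theorem continuous_integralOperator :
    Continuous (integralOperator : Lp ℂ 2 (ν.prod μ) → Lp ℂ 2 μ →L[ℂ] Lp ℂ 2 ν) := by
  refine LipschitzWith.continuous (K := 1) (LipschitzWith.of_dist_le_mul fun k l => ?_)
  rw [dist_eq_norm, dist_eq_norm, ← integralOperator_sub, NNReal.coe_one, one_mul]
  exact LinearMap.mkContinuous_norm_le _ (norm_nonneg _) _

end IntegralOperatorContinuity

/-! ### Arrays as contractions -/

theorem LinearMap.norm_map_le_of_unit {E F : Type*} [NormedAddCommGroup E] [NormedSpace ℂ E]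
    [NormedAddCommGroup F] [NormedSpace ℂ F] (L : E →ₗ[ℂ] F) (hL : ∀ v, ‖v‖ = 1 → ‖L v‖ ≤ 1)
    (v : E) : ‖L v‖ ≤ 1 * ‖v‖ := by
  rcases eq_or_ne v 0 with rfl | hv
  · simp
  have h := hL ((‖v‖⁻¹ : ℂ) • v) (by simp [norm_smul, hv])
  rw [map_smul, norm_smul, norm_inv, Complex.norm_real, norm_norm,
    inv_mul_le_iff₀ (norm_pos_iff.2 hv)] at h
  linarith

/-- A transmit array as a bounded operator. -/
def ContinuousTxArray.toCLM {n : ℕ} {L : Set ℝ} (φ : ContinuousTxArray n L) :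
    EuclideanSpace ℂ (Fin n) →L[ℂ] L2 L :=
  φ.toLinearMap.mkContinuous 1 (φ.toLinearMap.norm_map_le_of_unit φ.norm_le_one)

theorem ContinuousTxArray.norm_toCLM_le {n : ℕ} {L : Set ℝ} (φ : ContinuousTxArray n L) :
    ‖φ.toCLM‖ ≤ 1 :=
  LinearMap.mkContinuous_norm_le _ zero_le_one _

/-- A receive array as a bounded operator. -/
def ContinuousRxArray.toCLM {n : ℕ} {L : Set ℝ} (φ : ContinuousRxArray n L) :
    L2 L →L[ℂ] EuclideanSpace ℂ (Fin n) :=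
  φ.toLinearMap.mkContinuous 1 (φ.toLinearMap.norm_map_le_of_unit φ.norm_le_one)

theorem ContinuousRxArray.norm_toCLM_le {n : ℕ} {L : Set ℝ} (φ : ContinuousRxArray n L) :
    ‖φ.toCLM‖ ≤ 1 :=
  LinearMap.mkContinuous_norm_le _ zero_le_one _

/-! ### Comparison of the two capacities -/

section Comparison

variable {Lt Lr : Set ℝ} {Nt Nr : ℕ}

theorem inducedChannel_apply (φr : ContinuousRxArray Nr Lr) (T : L2 Lt →L[ℂ] L2 Lr)
    (φt : ContinuousTxArray Nt Lt) (i : Fin Nr) (j : Fin Nt) :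
    inducedChannel φr T φt i j = φr.toCLM (T (φt.toCLM (EuclideanSpace.single j 1))) i :=
  rfl

/-- The transmit array does not increase power: `tr (M M†) = ‖φ D‖²_HS ≤ ‖φ‖² ‖D‖²_HS`, and `‖D‖²_HS
= tr (D Dᴴ)`. -/
theorem positiveTrace_comp_adjoint_le {M : EuclideanSpace ℂ (Fin Nt) →L[ℂ] L2 Lt}
    {φ : EuclideanSpace ℂ (Fin Nt) →L[ℂ] L2 Lt} (hφ : ‖φ‖ ≤ 1) (D : Matrix (Fin Nt) (Fin Nt) ℂ)
    (hM : M = φ ∘L Matrix.toEuclideanCLM (𝕜 := ℂ) D) :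
    positiveTrace (M ∘L ContinuousLinearMap.adjoint M) ≤
      ENNReal.ofReal (D * D.conjTranspose).trace.re := by
  have h := positiveTrace_adjoint_comp (ContinuousLinearMap.adjoint M)
  rw [ContinuousLinearMap.adjoint_adjoint] at h
  rw [h, ← tsum_enorm_sq_adjoint (EuclideanSpace.basisFun (Fin Nt) ℂ).toHilbertBasis, hM]
  simp only [ContinuousLinearMap.comp_apply]
  refine (tsum_enorm_sq_comp_le _ _ _).trans ?_
  have h1 : ‖φ‖ₑ ^ 2 ≤ 1 := by
    have : ‖φ‖ₑ ≤ 1 := by rw [← ofReal_norm]; exact ENNReal.ofReal_le_one.2 hφ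
    exact pow_le_one' this 2
  refine (mul_le_of_le_one_left' h1).trans (le_of_eq ?_)
  rw [tsum_fintype]
  have h2 : ∀ k, ‖Matrix.toEuclideanCLM (𝕜 := ℂ) D
      ((EuclideanSpace.basisFun (Fin Nt) ℂ).toHilbertBasis k)‖ₑ ^ 2 =
      ENNReal.ofReal (∑ j, ‖D j k‖ ^ 2) := by
    intro k
    rw [← ofReal_norm, ← ENNReal.ofReal_pow (norm_nonneg _), EuclideanSpace.norm_sq_eq]
    congr 1
    refine Finset.sum_congr rfl fun j _ => ?_
    simp [Matrix.ofLp_toEuclideanCLM]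
  simp only [h2]
  rw [← ENNReal.ofReal_sum_of_nonneg fun k _ => by positivity, Finset.sum_comm, Matrix.trace,
    Complex.re_sum]
  congr 1
  refine Finset.sum_congr rfl fun j _ => ?_
  rw [Matrix.diag_apply, Matrix.mul_apply, Complex.re_sum]
  refine Finset.sum_congr rfl fun k _ => ?_
  rw [Matrix.conjTranspose_apply, ← starRingEnd_apply, Complex.mul_conj, Complex.ofReal_re,
    Complex.normSq_eq_norm_sq]

theorem positiveTrace_noise_scaled_ne_top {S : L2 Lt →L[ℂ] L2 Lt} (hS : S.IsPositive)
    (ht : positiveTrace S ≠ ∞) (T : L2 Lt →L[ℂ] L2 Lr) (σ : ℝ) :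
    (((1 / σ ^ 2 : ℝ) : ℂ) • (T ∘L S ∘L ContinuousLinearMap.adjoint T)).IsPositive ∧
    positiveTrace (((1 / σ ^ 2 : ℝ) : ℂ) • (T ∘L S ∘L ContinuousLinearMap.adjoint T)) ≠ ∞ := by
  rw [ContinuousLinearMap.inv_sq_smul_conj_adjoint]
  refine ⟨hS.conj_adjoint _, ne_top_of_le_ne_top ?_ (positiveTrace_conj_adjoint_le hS _)⟩
  exact ENNReal.mul_ne_top (by simp) ht

theorem discreteCapacity_le_continuousCapacity (φr : ContinuousRxArray Nr Lr)
    (φt : ContinuousTxArray Nt Lt) (T : L2 Lt →L[ℂ] L2 Lr) (P σ : ℝ) :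
    discreteCapacity (inducedChannel φr T φt) P σ ≤ continuousCapacity T P σ := by
  refine iSup₂_le fun C hC => ?_
  obtain ⟨D, hD⟩ : ∃ D : Matrix (Fin Nt) (Fin Nt) ℂ, C = D * D.conjTranspose := by
    open scoped MatrixOrder in
    obtain ⟨E, hE⟩ := CStarAlgebra.nonneg_iff_eq_star_mul_self.mp hC.1.nonneg
    exact ⟨E.conjTranspose, by rw [Matrix.conjTranspose_conjTranspose]; exact hE⟩
  -- For white `w`, the input `D w` has covariance `C` and the emitted field `M w` has covariance `M
  -- M†`; this is the competing covariance operator.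
  set M : EuclideanSpace ℂ (Fin Nt) →L[ℂ] L2 Lt :=
    φt.toCLM ∘L Matrix.toEuclideanCLM (𝕜 := ℂ) D with hM
  set S : L2 Lt →L[ℂ] L2 Lt := M ∘L ContinuousLinearMap.adjoint M with hSdef
  have hS : S.IsPositive := ContinuousLinearMap.isPositive_self_comp_adjoint M
  have hSP : positiveTrace S ≤ ENNReal.ofReal P :=
    (positiveTrace_comp_adjoint_le φt.norm_toCLM_le D hM).trans
      (ENNReal.ofReal_le_ofReal (hD ▸ hC.2))
  have hSt : positiveTrace S ≠ ∞ := ne_top_of_le_ne_top ENNReal.ofReal_ne_top hSP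
  refine le_trans (ENNReal.ofReal_le_ofReal ?_)
    (le_iSup₂_of_le S ⟨hS, hSP⟩ le_rfl)
  obtain ⟨-, hAt⟩ := positiveTrace_noise_scaled_ne_top hS hSt T σ
  set N : EuclideanSpace ℂ (Fin Nt) →L[ℂ] L2 Lr := (((1 / σ : ℝ) : ℂ) • T) ∘L M with hN
  have hA : ((1 / σ ^ 2 : ℝ) : ℂ) • (T ∘L S ∘L ContinuousLinearMap.adjoint T) =
      N ∘L ContinuousLinearMap.adjoint N := by
    rw [ContinuousLinearMap.inv_sq_smul_conj_adjoint, hN, ContinuousLinearMap.adjoint_comp]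
    rfl
  set u : Fin Nt → L2 Lr := fun k => N (EuclideanSpace.single k 1) with hu
  -- The columns are the received images of the `u k`, so `W = σ⁻¹ H D` for the induced channel
  -- matrix `H`.
  let W : Matrix (Fin Nr) (Fin Nt) ℂ := Matrix.of fun r k => φr.toCLM (u k) r
  have hdisc : ((1 / σ ^ 2 : ℝ) : ℂ) •
      (inducedChannel φr T φt * C * (inducedChannel φr T φt).conjTranspose) =
      W * W.conjTranspose := by
    have hW : W = ((1 / σ : ℝ) : ℂ) • (inducedChannel φr T φt * D) := by
      ext r k
      have hDk : Matrix.toEuclideanCLM (𝕜 := ℂ) D (EuclideanSpace.single k 1) =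
          ∑ j, D j k • EuclideanSpace.single j (1 : ℂ) := by
        ext j
        simp [Matrix.ofLp_toEuclideanCLM, Finset.sum_apply, Pi.single_apply]
      simp only [W, Matrix.of_apply, hu, hN, hM, smul_apply,
        ContinuousLinearMap.comp_apply, hDk, map_smul, map_sum, Matrix.smul_apply,
        Matrix.mul_apply, inducedChannel_apply, PiLp.smul_apply, WithLp.ofLp_sum,
        Finset.sum_apply, smul_eq_mul]
      congr 1
      exact Finset.sum_congr rfl fun j _ => mul_comm _ _
    rw [hW, hD, Matrix.conjTranspose_smul, Matrix.conjTranspose_mul, Matrix.smul_mul,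
      Matrix.mul_smul, smul_smul]
    simp only [Matrix.mul_assoc]
    congr 1
    simp [pow_two]
  have hWgram : W.conjTranspose * W = Matrix.gram ℂ (φr.toCLM ∘ u) := by
    ext k l
    simp only [Matrix.mul_apply, Matrix.conjTranspose_apply, W, Matrix.of_apply,
      Matrix.gram_apply, Function.comp_apply, PiLp.inner_apply, RCLike.inner_apply]
    exact Finset.sum_congr rfl fun r _ => mul_comm _ _
  have hle : (Matrix.gram ℂ u - Matrix.gram ℂ (φr.toCLM ∘ u)).PosSemidef := by
    -- This gives `‖φr‖² gram u - gram (φr ∘ u) ⪰ 0`; adding `(1 - ‖φr‖²) gram u ⪰ 0` removes the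
    -- norm factor.
    have h1 := Matrix.posSemidef_opNorm_smul_gram_sub_gram (𝕜 := ℂ) u φr.toCLM
    have h2 : (0 : ℝ) ≤ 1 - ‖φr.toCLM‖ ^ 2 :=
      sub_nonneg.2 (pow_le_one₀ (norm_nonneg _) φr.norm_toCLM_le)
    have h3 := ((Matrix.posSemidef_gram ℂ u).smul h2).add h1
    rwa [sub_smul, one_smul, sub_add_sub_cancel] at h3
  have hdet := (Matrix.posSemidef_gram ℂ (φr.toCLM ∘ u)).det_one_add_mono hle
  have hone := (Matrix.posSemidef_gram ℂ (φr.toCLM ∘ u)).one_le_det_one_add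
  -- The outputs live in different spaces; Sylvester on each side brings both determinants to size
  -- `Nt`.
  rw [discreteRate, continuousRate, hdisc, Matrix.det_one_add_mul_comm, hWgram, hA,
    fredholmDet_comp_adjoint N (hA ▸ hAt)]
  exact Real.log_le_log (zero_lt_one.trans_le (Complex.le_def.1 hone).1)
    (Complex.le_def.1 hdet).1

end Comparison

/-! ### Measurability of the capacities -/

section Measurability

/-- Truncation at zero removes the singularity: the function vanishes for `|x| ≤ 1`, including `x =
0`. `Real.log` is even, which gives `log (max 1 |x|)` throughout. -/
theorem continuous_ofReal_log : Continuous fun x : ℝ => ENNReal.ofReal (Real.log x) := by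
  have h : (fun x : ℝ => ENNReal.ofReal (Real.log x)) =
      fun x : ℝ => ENNReal.ofReal (Real.log (max 1 |x|)) := by
    ext x
    rcases le_total |x| 1 with hx | hx
    · rw [max_eq_left hx, Real.log_one, ← Real.log_abs,
        ENNReal.ofReal_of_nonpos (Real.log_nonpos (abs_nonneg _) hx), ENNReal.ofReal_zero]
    · rw [max_eq_right hx, Real.log_abs]
  rw [h]
  refine ENNReal.continuous_ofReal.comp (Continuous.log (by fun_prop) fun x => ?_)
  exact (zero_lt_one.trans_le (le_max_left _ _)).ne'

variable {Lt Lr : Set ℝ} {Nt Nr : ℕ}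

/-- The supremum is over an uncountable family, so measurability goes through lower semicontinuity,
which arbitrary suprema preserve. -/
theorem lowerSemicontinuous_discreteCapacity (P σ : ℝ) :
    LowerSemicontinuous fun H : Matrix (Fin Nr) (Fin Nt) ℂ => discreteCapacity H P σ := by
  refine lowerSemicontinuous_biSup fun C _ => Continuous.lowerSemicontinuous ?_
  refine continuous_ofReal_log.comp (Complex.continuous_re.comp (Continuous.matrix_det ?_))
  fun_prop

theorem continuous_inducedChannel (φr : ContinuousRxArray Nr Lr) (φt : ContinuousTxArray Nt Lt) :
    Continuous fun T : L2 Lt →L[ℂ] L2 Lr => inducedChannel φr T φt := by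
  refine continuous_pi fun i => continuous_pi fun j => ?_
  simp only [inducedChannel_apply]
  fun_prop

theorem lowerSemicontinuous_continuousCapacity (P σ : ℝ) :
    LowerSemicontinuous fun T : L2 Lt →L[ℂ] L2 Lr => continuousCapacity T P σ := by
  refine lowerSemicontinuous_biSup fun S hS => ?_
  have ht : positiveTrace S ≠ ∞ := ne_top_of_le_ne_top ENNReal.ofReal_ne_top hS.2
  have h (T : L2 Lt →L[ℂ] L2 Lr) := positiveTrace_noise_scaled_ne_top hS.1 ht T σ
  have heq := fun T : L2 Lt →L[ℂ] L2 Lr => ofReal_log_fredholmDet_eq_iSup (h T).1 (h T).2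
  simp only [continuousRate, heq]
  refine lowerSemicontinuous_iSup fun F => Continuous.lowerSemicontinuous ?_
  have hadj : Continuous fun T : L2 Lt →L[ℂ] L2 Lr => ContinuousLinearMap.adjoint T :=
    ContinuousLinearMap.adjoint.continuous
  refine continuous_ofReal_log.comp (Complex.continuous_re.comp
    ((continuous_compressionDet F).comp ?_))
  fun_prop

theorem aemeasurable_comp_of_lowerSemicontinuous {Ω E : Type*} [MeasurableSpace Ω]
    {ℙ : Measure Ω} [TopologicalSpace E] [TopologicalSpace.PseudoMetrizableSpace E]
    {f : E → ℝ≥0∞} (hf : LowerSemicontinuous f) {h : Ω → E} (hh : AEStronglyMeasurable h ℙ) :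
    AEMeasurable (fun ω => f (h ω)) ℙ := by
  borelize E
  exact hf.measurable.comp_aemeasurable hh.aemeasurable

end Measurability

end

theorem lemma2 {Ω : Type*} [MeasurableSpace Ω] (ℙ : Measure Ω) [IsProbabilityMeasure ℙ]
    (Lt Lr : Set ℝ) (hLt : Lt.OrdConnected) (hLr : Lr.OrdConnected)
    (Nt Nr : ℕ) (φt : ContinuousTxArray Nt Lt) (φr : ContinuousRxArray Nr Lr)
    (P σ : ℝ) (hP : 0 ≤ P) (hσ : 0 < σ)
    (h : Ω → ChannelKernel Lr Lt) (hh : AEStronglyMeasurable h ℙ) :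
    (∀ᵐ ω ∂ℙ,
      discreteCapacity (inducedChannel φr (channelOperator (h ω)) φt) P σ ≤
        continuousCapacity (channelOperator (h ω)) P σ) ∧
    AEMeasurable
      (fun ω => discreteCapacity (inducedChannel φr (channelOperator (h ω)) φt) P σ) ℙ ∧
    AEMeasurable (fun ω => continuousCapacity (channelOperator (h ω)) P σ) ℙ ∧
    ∫⁻ ω, discreteCapacity (inducedChannel φr (channelOperator (h ω)) φt) P σ ∂ℙ ≤
      ∫⁻ ω, continuousCapacity (channelOperator (h ω)) P σ ∂ℙ := by
  have hc : Continuous (channelOperator : ChannelKernel Lr Lt → L2 Lt →L[ℂ] L2 Lr) :=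
    continuous_integralOperator
  have hle : ∀ ω, discreteCapacity (inducedChannel φr (channelOperator (h ω)) φt) P σ ≤
      continuousCapacity (channelOperator (h ω)) P σ := fun ω =>
    discreteCapacity_le_continuousCapacity φr φt _ P σ
  exact ⟨.of_forall hle,
    aemeasurable_comp_of_lowerSemicontinuous ((lowerSemicontinuous_discreteCapacity P σ).comp
      ((continuous_inducedChannel φr φt).comp hc)) hh,
    aemeasurable_comp_of_lowerSemicontinuous
      ((lowerSemicontinuous_continuousCapacity P σ).comp hc) hh,
    lintegral_mono hle⟩
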